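/- Let $\mathcal X,\mathcal Y$ be finite sets and let $q$ be a probability mass function (p.m.f.) on $\mathcal X\times\mathcal Y$. For $n\in\mathbb N$ and real numbers $R,R_1,R_2\ge 0$, an $(n,2^{nR},2^{nR_1},2^{nR_2})$ simulation code consists of conditional p.m.f.'s $p(m|w_1,w_2)$, $p(x^n|m,w_1)$ and $p(y^n|m,w_2)$, where $m\in[1:2^{nR}]$, $w_1\in[1:2^{nR_1}]$, $w_2\in[1:2^{nR_2}]$, $x^n\in\mathcal X^n$, $y^n\in\mathcal Y^n$, and $[1:a]:=\{1,\dots,\lfloor a\rfloor\}$. With $W_1,W_2$ independent and uniform on $[1:2^{nR_1}]$ and $[1:2^{nR_2}]$, the code induces on $\mathcal X^n\times\mathcal Y^n$ the p.m.f. $$p^{(\mathrm{induced})}(x^n,y^n)=\frac{1}{\lfloor 2^{nR_1}\rfloor\lfloor 2^{nR_2}\rfloor}\sum_{w_1,w_2,m}p(m|w_1,w_2)\,p(x^n|m,w_1)\,p(y^n|m,w_2).$$ The triplet $(R,R_1,R_2)$ is achievable for $q$ if there is a sequence of $(n,2^{nR},2^{nR_1},2^{nR_2})$ simulation codes, $n\in\mathbb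 N$, with $$\lim_{n\to\infty}\ \frac12\sum_{x^n,y^n}\Big|p^{(\mathrm{induced})}(x^n,y^n)-\prod_{i=1}^n q(x_i,y_i)\Big|=0.$$ Let $\mathcal R\subseteq\mathbb R^3$ be the closure of the set of all achievable triplets, and let the optimal transmission rate under no shared randomness be $R^{\mathrm{NO\text{-}SR}}_{\mathrm{opt}}:=\inf\{R:(R,0,0)\in\mathcal R\}$. Let $$C(X;Y):=\min_{X-U-Y} I(X,Y;U)$$ be Wyner's common information, where the minimum is over all random variables $U$ with a finite alphabet, jointly distributed with $(X,Y)\sim q$, such that $X-U-Y$ is a Markov chain, and mutual information is measured in bits. **Theorem (no shared randomness).** The minimum defining $C(X;Y)$ is attained, the set $\{R:(R,0,0)\in\mathcal R\}$ is nonempty and bounded below, and $$R^{\mathrm{NO\text{-}SR}}_{\mathrm{opt}}=C(X;Y).$$ -/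

import Mathlib

noncomputable section

namespace CoordSim

/-- Total variation distance `½ ∑ |p - q|` of two real-valued functions on a finite set. -/
def tvDist {A : Type*} [Fintype A] (p q : A → ℝ) : ℝ :=
  ∑ a, (1 / 2 : ℝ) * |p a - q a|

/-- First marginal of a joint p.m.f. on a product of finite sets. -/
def margFst {A B : Type*} [Fintype B] (p : A × B → ℝ) (a : A) : ℝ :=
  ∑ b, p (a, b)

/-- Second marginal of a joint p.m.f. on a product of finite sets. -/
def margSnd {A B : Type*} [Fintype A] (p : A × B → ℝ) (b : B) : ℝ :=
  ∑ a, p (a, b)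

/-- Mutual information `I(A;B)` in bits of a joint p.m.f. on a product of finite sets
(terms with `p (a, b) = 0` contribute `0`). -/
def mutualInfo {A B : Type*} [Fintype A] [Fintype B] (p : A × B → ℝ) : ℝ :=
  ∑ a, ∑ b, p (a, b) * Real.logb 2 (p (a, b) / (margFst p a * margSnd p b))

/-- The Markov chain `X - U - Y` for a joint p.m.f. `p(x, y, u)`, that is
`p(x,y,u) = p(u) p(x|u) p(y|u)`, written without division as
`p(x,y,u) p(u) = p(x,u) p(y,u)`. -/
def IsMarkov {X Y U : Type*} [Fintype X] [Fintype Y] (p : (X × Y) × U → ℝ) : Prop :=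
  ∀ (x : X) (y : Y) (u : U),
    p ((x, y), u) * margSnd p u = (∑ y', p ((x, y'), u)) * (∑ x', p ((x', y), u))

/-- The values `I(X,Y;U)` over all random variables `U` with a finite alphabet, jointly
distributed with `(X, Y) ∼ q` so that `X - U - Y` is a Markov chain. -/
def wynerValues {X Y : Type*} [Fintype X] [Fintype Y] (q : X × Y → ℝ) : Set ℝ :=
  {I | ∃ (k : ℕ) (p : (X × Y) × Fin k → ℝ), p ∈ stdSimplex ℝ ((X × Y) × Fin k) ∧
    (∀ z, margFst p z = q z) ∧ IsMarkov p ∧ I = mutualInfo p}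

/-- Wyner's common information `C(X;Y)`. -/
def wynerCommonInfo {X Y : Type*} [Fintype X] [Fintype Y] (q : X × Y → ℝ) : ℝ :=
  sInf (wynerValues q)

/-- The number of elements of the index set `[1 : 2^{nR}]`. -/
def numIdx (n : ℕ) (R : ℝ) : ℕ := ⌊(2 : ℝ) ^ ((n : ℝ) * R)⌋₊

/-- An `(n, 2^{nR}, 2^{nR₁}, 2^{nR₂})` simulation code: the random maps
`p(m | w₁, w₂)`, `p(xⁿ | m, w₁)` and `p(yⁿ | m, w₂)`. -/
structure SimCode (X Y : Type*) [Fintype X] [Fintype Y] (n : ℕ) (R R₁ R₂ : ℝ) where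
  enc : Fin (numIdx n R₁) → Fin (numIdx n R₂) → Fin (numIdx n R) → ℝ
  enc_mem : ∀ w₁ w₂, enc w₁ w₂ ∈ stdSimplex ℝ (Fin (numIdx n R))
  dec₁ : Fin (numIdx n R) → Fin (numIdx n R₁) → (Fin n → X) → ℝ
  dec₁_mem : ∀ m w₁, dec₁ m w₁ ∈ stdSimplex ℝ (Fin n → X)
  dec₂ : Fin (numIdx n R) → Fin (numIdx n R₂) → (Fin n → Y) → ℝ
  dec₂_mem : ∀ m w₂, dec₂ m w₂ ∈ stdSimplex ℝ (Fin n → Y)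

/-- The joint p.m.f. of `(W₁, W₂, M, Xⁿ, Yⁿ)`, where `W₁`, `W₂` are independent and uniform. -/
def SimCode.joint {X Y : Type*} [Fintype X] [Fintype Y] {n : ℕ} {R R₁ R₂ : ℝ}
    (c : SimCode X Y n R R₁ R₂) (w₁ : Fin (numIdx n R₁)) (w₂ : Fin (numIdx n R₂))
    (m : Fin (numIdx n R)) (x : Fin n → X) (y : Fin n → Y) : ℝ :=
  c.enc w₁ w₂ m * c.dec₁ m w₁ x * c.dec₂ m w₂ y /
    ((numIdx n R₁ : ℝ) * (numIdx n R₂ : ℝ))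

/-- The induced p.m.f. of `(Xⁿ, Yⁿ)`. -/
def SimCode.induced {X Y : Type*} [Fintype X] [Fintype Y] {n : ℕ} {R R₁ R₂ : ℝ}
    (c : SimCode X Y n R R₁ R₂) (z : (Fin n → X) × (Fin n → Y)) : ℝ :=
  ∑ w₁, ∑ w₂, ∑ m, c.joint w₁ w₂ m z.1 z.2

/-- The i.i.d. p.m.f. `q⁽ⁿ⁾(xⁿ, yⁿ) = ∏ᵢ q(xᵢ, yᵢ)`. -/
def iidPMF {X Y : Type*} (q : X × Y → ℝ) (n : ℕ) (z : (Fin n → X) × (Fin n → Y)) : ℝ :=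
  ∏ i, q (z.1 i, z.2 i)

/-- Achievability of the (nonnegative) rate triplet `(R, R₁, R₂)` for `q`. -/
def Achievable {X Y : Type*} [Fintype X] [Fintype Y] (q : X × Y → ℝ) (R R₁ R₂ : ℝ) : Prop :=
  0 ≤ R ∧ 0 ≤ R₁ ∧ 0 ≤ R₂ ∧
    ∃ c : (n : ℕ) → SimCode X Y n R R₁ R₂,
      Filter.Tendsto (fun n => tvDist (c n).induced (iidPMF q n)) Filter.atTop (nhds 0)

/-- The simulation rate region: closure of the set of achievable rate triplets. -/
def rateRegion {X Y : Type*} [Fintype X] [Fintype Y] (q : X × Y → ℝ) : Set (ℝ × ℝ × ℝ) :=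
  closure {r | Achievable q r.1 r.2.1 r.2.2}

/-- The transmission rates that suffice when the shared randomness rates go to zero. -/
def noSRRates {X Y : Type*} [Fintype X] [Fintype Y] (q : X × Y → ℝ) : Set ℝ :=
  {R | (R, (0 : ℝ), (0 : ℝ)) ∈ rateRegion q}

/-- The optimal transmission rate under no shared randomness. -/
def optRateNoSR {X Y : Type*} [Fintype X] [Fintype Y] (q : X × Y → ℝ) : ℝ :=
  sInf (noSRRates q)

end CoordSim

end

/-! Let `K` be the convex hull of the pairs (P ⊗ Q, H(P) + H(Q)), with P and Q p.m.f.'s on the two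
alphabets. A point (q, t) of `K` is a decomposition of q into product laws, that is, a variable U
with X - U - Y, and t = H(X,Y|U). So the values I(X,Y;U) are the numbers (H(q) - t) / log 2 with (q,
t) in `K` (`mem_wynerValues_iff`). By Carathéodory `K` is compact, so the minimum is attained
(`isLeast_wynerCommonInfo`).

Converse: given V = (W₁, W₂, M), the outputs Xⁿ and Yⁿ are independent. Adjoining a uniform time
index to V gives a point (r, t) of `K`, where r is near q and t is at least H(q) - (R + R₁ + R₂) log
2 up to a vanishing error (`exists_mem_convexHull_of_simCode`). A limit point in `K` yields C ≤ R +
R₁ + R₂, a closed condition which therefore holds on the whole region. Compactness thus replaces any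
continuity of C in q.

Achievability: for R > C take an optimal U, a random codebook of about 2^{nR} words drawn i.i.d.
from its law, a uniform message, and memoryless decoders P(x|u), Q(y|u). Soft covering
(`exists_codebook`) with a Chernoff bound (`sum_atypical_le`) makes the output law converge to the
i.i.d. law. -/

namespace CoordSim

open Real Filter

/-! ### Finite p.m.f.'s: images, products, mixtures. -/

/-- Shannon entropy in nats. -/
noncomputable def entropy {A : Type*} [Fintype A] (p : A → ℝ) : ℝ :=
  ∑ a, negMulLog (p a)

open Classical in
/-- Image of a p.m.f. under a map. -/
noncomputable def pushforward {A B : Type*} [Fintype A] (f : A → B) (p : A → ℝ) (b : B) : ℝ :=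
  ∑ a, if f a = b then p a else 0

lemma sum_pushforward_mul {A B : Type*} [Fintype A] [Fintype B] (f : A → B) (p : A → ℝ)
    (g : B → ℝ) : ∑ b, pushforward f p b * g b = ∑ a, p a * g (f a) := by
  classical
  simp only [pushforward, Finset.sum_mul]
  rw [Finset.sum_comm]
  refine Finset.sum_congr rfl fun a _ => ?_
  rw [Finset.sum_eq_single (f a)] <;> simp +contextual [eq_comm]

lemma pushforward_nonneg {A B : Type*} [Fintype A] {f : A → B} {p : A → ℝ}
    (hp : ∀ a, 0 ≤ p a) (b : B) : 0 ≤ pushforward f p b :=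
  Finset.sum_nonneg fun a _ => by split_ifs <;> simp [hp a]

lemma le_pushforward {A B : Type*} [Fintype A] {f : A → B} {p : A → ℝ}
    (hp : ∀ a, 0 ≤ p a) (a : A) : p a ≤ pushforward f p (f a) := by
  classical
  refine le_trans ?_ (Finset.single_le_sum (f := fun a' => if f a' = f a then p a' else 0)
    (fun i _ => ?_) (Finset.mem_univ a))
  · simp
  · split_ifs <;> simp [hp i]

lemma pushforward_mem {A B : Type*} [Fintype A] [Fintype B] (f : A → B) {p : A → ℝ}
    (hp : p ∈ stdSimplex ℝ A) : pushforward f p ∈ stdSimplex ℝ B := by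
  refine ⟨pushforward_nonneg hp.1, ?_⟩
  simpa [hp.2] using sum_pushforward_mul f p (fun _ => 1)

lemma abs_pushforward_sub_le {A B : Type*} [Fintype A] (f : A → B) (p q : A → ℝ) (b : B) :
    |pushforward f p b - pushforward f q b| ≤ ∑ a, |p a - q a| := by
  classical
  rw [pushforward, pushforward, ← Finset.sum_sub_distrib]
  refine (Finset.abs_sum_le_sum_abs _ _).trans (Finset.sum_le_sum fun a _ => ?_)
  split_ifs <;> simp

lemma pushforward_sum_smul {A B U : Type*} [Fintype A] [Fintype U] (f : A → B) (w : U → ℝ)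
    (p : U → A → ℝ) (b : B) :
    pushforward f (fun a => ∑ u, w u * p u a) b = ∑ u, w u * pushforward f (p u) b := by
  classical
  simp only [pushforward, Finset.mul_sum]
  rw [Finset.sum_comm]
  refine Finset.sum_congr rfl fun a _ => ?_
  split_ifs <;> simp

lemma pushforward_prodMap {A B A' B' : Type*} [Fintype A] [Fintype B] (f : A → A') (g : B → B')
    (p : A → ℝ) (q : B → ℝ) (z : A' × B') :
    pushforward (Prod.map f g) (fun z => p z.1 * q z.2) z =
      pushforward f p z.1 * pushforward g q z.2 := by
  classical
  obtain ⟨a, b⟩ := z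
  simp only [pushforward, Finset.sum_mul_sum, Fintype.sum_prod_type, Prod.map, Prod.mk.injEq]
  refine Finset.sum_congr rfl fun x _ => Finset.sum_congr rfl fun y _ => ?_
  by_cases h1 : f x = a <;> by_cases h2 : g y = b <;> simp [h1, h2]

lemma pushforward_eval_pi {A : Type*} [Fintype A] {n : ℕ} (q : A → ℝ) (hq : ∑ a, q a = 1)
    (i : Fin n) (a : A) :
    pushforward (fun x : Fin n → A => x i) (fun x => ∏ j, q (x j)) a = q a := by
  classical
  -- Only the `i`-th factor is restricted to the value `a`; expanding the product of sums then gives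
  -- the marginal.
  have h := Fintype.prod_sum (fun (j : Fin n) (b : A) =>
    if j = i then (if b = a then q b else 0) else q b)
  have h1 : ∀ j : Fin n, (∑ b, if j = i then (if b = a then q b else 0) else q b) =
      if j = i then q a else 1 := by
    intro j
    split_ifs <;> simp [hq]
  simp only [h1, Finset.prod_ite_eq', Finset.mem_univ, if_true] at h
  rw [h, pushforward]
  refine Finset.sum_congr rfl fun x _ => ?_
  split_ifs with hx
  · refine Finset.prod_congr rfl fun j _ => ?_
    split_ifs with hj hj2
    · rfl
    · exact absurd (hj ▸ hx) hj2
    · rfl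
  · exact (Finset.prod_eq_zero (Finset.mem_univ i) (by simp [hx])).symm

lemma prod_mem_stdSimplex {A B : Type*} [Fintype A] [Fintype B] {p : A → ℝ} {q : B → ℝ}
    (hp : p ∈ stdSimplex ℝ A) (hq : q ∈ stdSimplex ℝ B) :
    (fun z : A × B => p z.1 * q z.2) ∈ stdSimplex ℝ (A × B) := by
  refine ⟨fun z => mul_nonneg (hp.1 _) (hq.1 _), ?_⟩
  rw [Fintype.sum_prod_type, ← Finset.sum_mul_sum, hp.2, hq.2, one_mul]

lemma pi_mem_stdSimplex {A : Type*} [Fintype A] {n : ℕ} {q : Fin n → A → ℝ}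
    (hq : ∀ i, q i ∈ stdSimplex ℝ A) :
    (fun x : Fin n → A => ∏ i, q i (x i)) ∈ stdSimplex ℝ (Fin n → A) := by
  classical
  refine ⟨fun z => Finset.prod_nonneg fun i _ => (hq i).1 _, ?_⟩
  rw [← Fintype.prod_sum]
  exact Finset.prod_eq_one fun i _ => (hq i).2

lemma mixture_mem_stdSimplex {A U : Type*} [Fintype A] [Fintype U] {w : U → ℝ} {p : U → A → ℝ}
    (hw : w ∈ stdSimplex ℝ U) (hp : ∀ u, p u ∈ stdSimplex ℝ A) :
    (fun a => ∑ u, w u * p u a) ∈ stdSimplex ℝ A := by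
  refine ⟨fun a => Finset.sum_nonneg fun u _ => mul_nonneg (hw.1 u) ((hp u).1 a), ?_⟩
  rw [Finset.sum_comm]
  simp [← Finset.mul_sum, (hp _).2, hw.2]

lemma le_one_of_mem_stdSimplex {A : Type*} [Fintype A] {p : A → ℝ} (hp : p ∈ stdSimplex ℝ A)
    (a : A) : p a ≤ 1 :=
  hp.2 ▸ Finset.single_le_sum (fun i _ => hp.1 i) (Finset.mem_univ a)

/-! ### Entropy identities and inequalities. -/

lemma continuous_entropy {A : Type*} [Fintype A] : Continuous (entropy : (A → ℝ) → ℝ) := by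
  unfold entropy
  fun_prop

lemma entropy_prod {A B : Type*} [Fintype A] [Fintype B] {p : A → ℝ} {q : B → ℝ}
    (hp : ∑ a, p a = 1) (hq : ∑ b, q b = 1) :
    entropy (fun z : A × B => p z.1 * q z.2) = entropy p + entropy q := by
  simp only [entropy, Fintype.sum_prod_type, negMulLog_mul, Finset.sum_add_distrib,
    ← Finset.sum_mul, ← Finset.mul_sum, hp, hq, one_mul]

lemma entropy_equiv {A B : Type*} [Fintype A] [Fintype B] (e : A ≃ B) (p : B → ℝ) :
    entropy (fun a => p (e a)) = entropy p :=
  e.sum_comp fun b => negMulLog (p b)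

lemma entropy_pi {A : Type*} [Fintype A] {q : A → ℝ} (hq : q ∈ stdSimplex ℝ A) (n : ℕ) :
    entropy (fun x : Fin n → A => ∏ i, q (x i)) = n * entropy q := by
  induction n with
  | zero => simp [entropy]
  | succ n ih =>
    rw [← entropy_equiv (Fin.consEquiv fun _ : Fin (n + 1) => A)]
    simp only [Fin.consEquiv, Equiv.coe_fn_mk, Fin.prod_univ_succ, Fin.cons_zero, Fin.cons_succ]
    refine (entropy_prod (p := q) (q := fun x : Fin n → A => ∏ i, q (x i)) hq.2
      (pi_mem_stdSimplex fun _ => hq).2).trans ?_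
    rw [ih]
    push_cast
    ring

lemma entropy_iidPMF {X Y : Type*} [Fintype X] [Fintype Y] {q : X × Y → ℝ}
    (hq : q ∈ stdSimplex ℝ (X × Y)) (n : ℕ) : entropy (iidPMF q n) = n * entropy q := by
  rw [← entropy_pi hq n,
    ← entropy_equiv (Equiv.arrowProdEquivProdArrow (Fin n) (fun _ => X) fun _ => Y)]
  rfl

lemma iidPMF_mem {X Y : Type*} [Fintype X] [Fintype Y] {q : X × Y → ℝ}
    (hq : q ∈ stdSimplex ℝ (X × Y)) (n : ℕ) :
    iidPMF q n ∈ stdSimplex ℝ ((Fin n → X) × (Fin n → Y)) := by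
  refine ⟨fun z => Finset.prod_nonneg fun i _ => hq.1 _, ?_⟩
  rw [← (pi_mem_stdSimplex (n := n) fun _ => hq).2,
    ← (Equiv.arrowProdEquivProdArrow (Fin n) (fun _ => X) fun _ => Y).sum_comp]
  rfl

lemma pushforward_iidPMF {X Y : Type*} [Fintype X] [Fintype Y] {q : X × Y → ℝ}
    (hq : q ∈ stdSimplex ℝ (X × Y)) {n : ℕ} (i : Fin n) (z : X × Y) :
    pushforward (Prod.map (fun x : Fin n → X => x i) (fun y : Fin n → Y => y i)) (iidPMF q n) z
      = q z := by
  classical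
  rw [← pushforward_eval_pi q hq.2 i z]
  exact ((Equiv.arrowProdEquivProdArrow (Fin n) (fun _ => X) fun _ => Y).sum_comp _).symm

/-- Gibbs' inequality. -/
lemma entropy_le_cross {A : Type*} [Fintype A] {p q : A → ℝ} (hp : p ∈ stdSimplex ℝ A)
    (hq : ∀ a, 0 ≤ q a) (hq1 : ∑ a, q a ≤ 1) (hpq : ∀ a, p a ≠ 0 → q a ≠ 0) :
    entropy p ≤ ∑ a, p a * -log (q a) := by
  have h : ∀ a, negMulLog (p a) ≤ p a * -log (q a) + (q a - p a) := by
    intro a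
    rcases eq_or_ne (p a) 0 with h0 | h0
    · simp [h0, hq a]
    · have hpa : 0 < p a := lt_of_le_of_ne (hp.1 a) (Ne.symm h0)
      have hqa : 0 < q a := lt_of_le_of_ne (hq a) (Ne.symm (hpq a h0))
      have := mul_le_mul_of_nonneg_left (log_le_sub_one_of_pos (div_pos hqa hpa)) hpa.le
      rw [log_div hqa.ne' hpa.ne', mul_sub, mul_sub, mul_div_cancel₀ _ hpa.ne'] at this
      rw [negMulLog]
      linarith
  have := Finset.sum_le_sum fun a (_ : a ∈ Finset.univ) => h a
  rw [Finset.sum_add_distrib, Finset.sum_sub_distrib, hp.2] at this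
  unfold entropy
  linarith

lemma entropy_le_log_card {A : Type*} [Fintype A] {p : A → ℝ} (hp : p ∈ stdSimplex ℝ A) :
    entropy p ≤ log (Fintype.card A) := by
  have : Nonempty A := by
    by_contra h
    rw [not_nonempty_iff] at h
    simpa using hp.2
  have hc : (Fintype.card A : ℝ) ≠ 0 := by simp
  have := entropy_le_cross (q := fun _ => (Fintype.card A : ℝ)⁻¹) hp (fun _ => by positivity)
    (by simp) (fun _ _ => by simp)
  simpa [← Finset.sum_mul, hp.2] using this

/-- Gibbs' inequality with the product of the marginals as reference law. -/
lemma entropy_le_sum_entropy_coord {A : Type*} [Fintype A] {n : ℕ} {P : (Fin n → A) → ℝ}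
    (hP : P ∈ stdSimplex ℝ (Fin n → A)) :
    entropy P ≤ ∑ i, entropy (pushforward (fun x : Fin n → A => x i) P) := by
  have hm := fun i => pushforward_mem (fun x : Fin n → A => x i) hP
  have hne : ∀ x, P x ≠ 0 → ∀ i, pushforward (fun x : Fin n → A => x i) P (x i) ≠ 0 := by
    intro x hx i
    have := le_pushforward (f := fun x : Fin n → A => x i) hP.1 x
    exact ((lt_of_le_of_ne (hP.1 x) (Ne.symm hx)).trans_le this).ne'
  have hQ := pi_mem_stdSimplex hm
  refine (entropy_le_cross hP hQ.1 hQ.2.le fun x hx =>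
    Finset.prod_ne_zero_iff.2 fun i _ => hne x hx i).trans_eq ?_
  have h1 : ∀ x, P x * -log (∏ i, pushforward (fun x : Fin n → A => x i) P (x i)) =
      ∑ i, P x * -log (pushforward (fun x : Fin n → A => x i) P (x i)) := by
    intro x
    rcases eq_or_ne (P x) 0 with h0 | h0
    · simp [h0]
    · rw [log_prod fun i _ => hne x h0 i, ← Finset.sum_neg_distrib, Finset.mul_sum]
  simp only [h1]
  rw [Finset.sum_comm]
  refine Finset.sum_congr rfl fun i _ => ?_
  rw [← sum_pushforward_mul (fun x : Fin n → A => x i) P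
    (fun a => -log (pushforward (fun x : Fin n → A => x i) P a)), entropy]
  exact Finset.sum_congr rfl fun a _ => by rw [negMulLog]; ring

lemma negMulLog_add_le {x y : ℝ} (hx : 0 ≤ x) (hy : 0 ≤ y) :
    negMulLog (x + y) ≤ negMulLog x + negMulLog y := by
  rcases hx.eq_or_lt with rfl | hx
  · simp
  rcases hy.eq_or_lt with rfl | hy
  · simp
  have h1 := mul_le_mul_of_nonneg_left (log_le_log hx (le_add_of_nonneg_right hy.le)) hx.le
  have h2 := mul_le_mul_of_nonneg_left (log_le_log hy (le_add_of_nonneg_left hx.le)) hy.le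
  simp only [negMulLog]
  linarith

lemma negMulLog_sum_le {U : Type*} (s : Finset U) {f : U → ℝ} (hf : ∀ u, 0 ≤ f u) :
    negMulLog (∑ u ∈ s, f u) ≤ ∑ u ∈ s, negMulLog (f u) := by
  classical
  induction s using Finset.induction_on with
  | empty => simp
  | insert a s ha ih =>
    rw [Finset.sum_insert ha, Finset.sum_insert ha]
    exact (negMulLog_add_le (hf a) (Finset.sum_nonneg fun u _ => hf u)).trans
      (by gcongr)

/-- H(A) ≤ H(A,U) = H(U) + H(A|U), and H(U) is at most the log of the alphabet size. In the converse
this term becomes the rate. -/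
lemma entropy_mixture_le {A U : Type*} [Fintype A] [Fintype U] {w : U → ℝ} {p : U → A → ℝ}
    (hw : w ∈ stdSimplex ℝ U) (hp : ∀ u, p u ∈ stdSimplex ℝ A) :
    entropy (fun a => ∑ u, w u * p u a) ≤
      log (Fintype.card U) + ∑ u, w u * entropy (p u) := by
  have h1 : entropy (fun a => ∑ u, w u * p u a) ≤ ∑ a, ∑ u, negMulLog (w u * p u a) :=
    Finset.sum_le_sum fun a _ => negMulLog_sum_le _ fun u => mul_nonneg (hw.1 u) ((hp u).1 a)
  have h2 : ∑ a, ∑ u, negMulLog (w u * p u a) = entropy w + ∑ u, w u * entropy (p u) := by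
    rw [Finset.sum_comm]
    simp only [negMulLog_mul, Finset.sum_add_distrib, ← Finset.sum_mul, ← Finset.mul_sum,
      (hp _).2, one_mul, entropy]
  linarith [entropy_le_log_card hw]

lemma negMulLog_sub_le {p q : ℝ} (hp : 0 ≤ p) (hp1 : p ≤ 1) (hq : 0 ≤ q) (hq1 : q ≤ 1) {N : ℝ}
    (hN : 1 ≤ N) :
    negMulLog q - negMulLog p ≤ |p - q| * log N + N⁻¹ + |p - q| := by
  have hN0 : 0 < N := by linarith
  rcases le_total p q with h | h
  · have h1 : negMulLog q ≤ negMulLog p + negMulLog (q - p) := by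
      simpa using negMulLog_add_le hp (sub_nonneg.2 h)
    -- With δ = q - p this is log x ≤ x - 1 at x = 1/(Nδ). Taking N to be the alphabet size, the
    -- terms N⁻¹ add up to 1, which is negligible after division by the blocklength.
    have h2 : negMulLog (q - p) ≤ (q - p) * log N + N⁻¹ - (q - p) := by
      rcases (sub_nonneg.2 h).eq_or_lt with h0 | h0
      · rw [← h0]; simp [hN0.le]
      · have := mul_le_mul_of_nonneg_left
          (log_le_sub_one_of_pos (inv_pos.2 (mul_pos hN0 h0))) h0.le
        rw [log_inv, log_mul hN0.ne' h0.ne', mul_sub] at this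
        have h3 : (q - p) * (N * (q - p))⁻¹ = N⁻¹ := by field_simp
        rw [h3] at this
        rw [negMulLog]
        linarith
    rw [abs_sub_comm, abs_of_nonneg (sub_nonneg.2 h)]
    linarith
  · rw [abs_of_nonneg (sub_nonneg.2 h)]
    have hl : 0 ≤ (p - q) * log N := mul_nonneg (sub_nonneg.2 h) (log_nonneg hN)
    have hi : 0 ≤ N⁻¹ := inv_nonneg.2 hN0.le
    suffices negMulLog q - negMulLog p ≤ p - q by linarith
    rcases hq.eq_or_lt with rfl | hq
    · simpa using by linarith [negMulLog_nonneg hp hp1]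
    · have hp0 : 0 < p := hq.trans_le h
      have h1 := mul_le_mul_of_nonneg_left (log_le_sub_one_of_pos (div_pos hp0 hq)) hq.le
      rw [log_div hp0.ne' hq.ne', mul_sub, mul_sub, mul_div_cancel₀ _ hq.ne'] at h1
      have h2 : (p - q) * log p ≤ 0 :=
        mul_nonpos_of_nonneg_of_nonpos (sub_nonneg.2 h) (log_nonpos hp0.le hp1)
      simp only [negMulLog]
      linarith

/-- A crude continuity bound for entropy. -/
lemma entropy_sub_le {A : Type*} [Fintype A] {p q : A → ℝ} (hp : p ∈ stdSimplex ℝ A)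
    (hq : q ∈ stdSimplex ℝ A) :
    entropy q - entropy p ≤ (∑ a, |p a - q a|) * (log (Fintype.card A) + 1) + 1 := by
  have : Nonempty A := by
    by_contra h
    rw [not_nonempty_iff] at h
    simpa using hp.2
  have hN : (1 : ℝ) ≤ Fintype.card A := by exact_mod_cast Fintype.card_pos
  have h := Finset.sum_le_sum fun a (_ : a ∈ Finset.univ) =>
    negMulLog_sub_le (hp.1 a) (le_one_of_mem_stdSimplex hp a) (hq.1 a)
      (le_one_of_mem_stdSimplex hq a) hN
  rw [Finset.sum_sub_distrib, Finset.sum_add_distrib, Finset.sum_add_distrib, ← Finset.sum_mul,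
    Finset.sum_const, Finset.card_univ, nsmul_eq_mul, mul_inv_cancel₀ (by linarith)] at h
  unfold entropy
  linarith

/-! ### The compact convex set of decompositions into product laws. -/

/-- In finite dimension, the convex hull of a compact set is compact. -/
lemma isCompact_convexHull {E : Type*} [NormedAddCommGroup E] [NormedSpace ℝ E]
    [FiniteDimensional ℝ E] {s : Set E} (hs : IsCompact s) : IsCompact (convexHull ℝ s) := by
  -- Carathéodory: at most `finrank + 1` points are needed, so the hull is a finite union of
  -- continuous images of compact sets.
  have h : convexHull ℝ s = ⋃ m ∈ Finset.range (Module.finrank ℝ E + 2),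
      (fun wz : (Fin m → ℝ) × (Fin m → E) => ∑ i, wz.1 i • wz.2 i) ''
        (stdSimplex ℝ (Fin m) ×ˢ Set.pi Set.univ fun _ => s) := by
    ext x
    simp only [Set.mem_iUnion, Set.mem_image, Finset.mem_range]
    constructor
    · intro hx
      obtain ⟨ι, _, z, w, hz, hi, hw, hw1, rfl⟩ := eq_pos_convex_span_of_mem_convexHull hx
      have e := (Fintype.equivFin ι).symm
      refine ⟨Fintype.card ι, ?_, (w ∘ e, z ∘ e), ⟨⟨fun i => (hw _).le, ?_⟩, fun i _ => ?_⟩, ?_⟩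
      · have h1 := hi.card_le_finrank_succ
        have h2 := Submodule.finrank_le (vectorSpan ℝ (Set.range z))
        omega
      · exact (e.sum_comp w).trans hw1
      · exact hz ⟨_, rfl⟩
      · exact e.sum_comp fun i => w i • z i
    · rintro ⟨m, -, ⟨w, z⟩, ⟨hw, hz⟩, rfl⟩
      exact mem_convexHull_of_exists_fintype w z hw.1 hw.2 (fun i => hz i trivial) rfl
  rw [h]
  refine (Finset.finite_toSet _).isCompact_biUnion fun m _ => IsCompact.image
    ((isCompact_stdSimplex ℝ _).prod (isCompact_univ_pi fun _ => hs)) ?_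
  fun_prop

/-- The product laws `P ⊗ Q` on `X × Y`, paired with their entropies. -/
def productPoints (X Y : Type*) [Fintype X] [Fintype Y] : Set ((X × Y → ℝ) × ℝ) :=
  (fun PQ : (X → ℝ) × (Y → ℝ) => (fun z : X × Y => PQ.1 z.1 * PQ.2 z.2,
    entropy PQ.1 + entropy PQ.2)) '' (stdSimplex ℝ X ×ˢ stdSimplex ℝ Y)

lemma isCompact_convexHull_productPoints (X Y : Type*) [Fintype X] [Fintype Y] :
    IsCompact (convexHull ℝ (productPoints X Y)) := by
  refine isCompact_convexHull (IsCompact.image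
    ((isCompact_stdSimplex ℝ X).prod (isCompact_stdSimplex ℝ Y)) ?_)
  have := continuous_entropy (A := X)
  have := continuous_entropy (A := Y)
  fun_prop

lemma mixture_mem_convexHull {X Y U : Type*} [Fintype X] [Fintype Y] [Fintype U] {w : U → ℝ}
    {P : U → X → ℝ} {Q : U → Y → ℝ} (hw : w ∈ stdSimplex ℝ U) (hP : ∀ u, P u ∈ stdSimplex ℝ X)
    (hQ : ∀ u, Q u ∈ stdSimplex ℝ Y) :
    ((fun z : X × Y => ∑ u, w u * (P u z.1 * Q u z.2)), ∑ u, w u * (entropy (P u) + entropy (Q u)))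
      ∈ convexHull ℝ (productPoints X Y) := by
  refine mem_convexHull_of_exists_fintype w
    (fun u => (fun z : X × Y => P u z.1 * Q u z.2, entropy (P u) + entropy (Q u))) hw.1 hw.2
    (fun u => ⟨(P u, Q u), ⟨hP u, hQ u⟩, rfl⟩) ?_
  refine Prod.ext ?_ ?_
  · ext z
    simp [Prod.fst_sum, Finset.sum_apply]
  · simp [Prod.snd_sum]

lemma exists_mixture_of_mem_convexHull {X Y : Type*} [Fintype X] [Fintype Y] {q : X × Y → ℝ}
    {t : ℝ} (h : (q, t) ∈ convexHull ℝ (productPoints X Y)) :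
    ∃ (k : ℕ) (w : Fin k → ℝ) (P : Fin k → X → ℝ) (Q : Fin k → Y → ℝ),
      w ∈ stdSimplex ℝ (Fin k) ∧ (∀ u, P u ∈ stdSimplex ℝ X) ∧ (∀ u, Q u ∈ stdSimplex ℝ Y) ∧
      (∀ z, ∑ u, w u * (P u z.1 * Q u z.2) = q z) ∧
      ∑ u, w u * (entropy (P u) + entropy (Q u)) = t := by
  obtain ⟨ι, _, w, a, hw₀, hw₁, ha, hs⟩ := mem_convexHull_iff_exists_fintype.1 h
  choose PQ hPQ heq using ha
  have e := (Fintype.equivFin ι).symm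
  refine ⟨Fintype.card ι, fun u => w (e u), fun u => (PQ (e u)).1, fun u => (PQ (e u)).2,
    ⟨fun u => hw₀ _, (e.sum_comp w).trans hw₁⟩, fun u => (hPQ _).1, fun u => (hPQ _).2, ?_, ?_⟩
  · intro z
    rw [e.sum_comp fun u => w u * ((PQ u).1 z.1 * (PQ u).2 z.2)]
    have := congrFun (congrArg Prod.fst hs) z
    simpa [Prod.fst_sum, Finset.sum_apply, ← heq] using this
  · rw [e.sum_comp fun u => w u * (entropy (PQ u).1 + entropy (PQ u).2)]
    have := congrArg Prod.snd hs
    simpa [Prod.snd_sum, ← heq] using this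

/-! ### Mutual information of mixtures and Wyner's common information. -/

/-- The joint p.m.f. of `(X, Y, U)` when `X` and `Y` are independent given `U`. -/
def mixtureJoint {X Y U : Type*} (w : U → ℝ) (P : U → X → ℝ) (Q : U → Y → ℝ)
    (z : (X × Y) × U) : ℝ :=
  w z.2 * (P z.2 z.1.1 * Q z.2 z.1.2)

section mixtureJoint

variable {X Y U : Type*} [Fintype X] [Fintype Y] {w : U → ℝ} {P : U → X → ℝ}
  {Q : U → Y → ℝ}

lemma margSnd_mixtureJoint (hP : ∀ u, P u ∈ stdSimplex ℝ X) (hQ : ∀ u, Q u ∈ stdSimplex ℝ Y)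
    (u : U) : margSnd (mixtureJoint w P Q) u = w u := by
  simp only [margSnd, mixtureJoint, ← Finset.mul_sum, (prod_mem_stdSimplex (hP u) (hQ u)).2,
    mul_one]

lemma isMarkov_mixtureJoint (hP : ∀ u, P u ∈ stdSimplex ℝ X) (hQ : ∀ u, Q u ∈ stdSimplex ℝ Y) :
    IsMarkov (mixtureJoint w P Q) := by
  intro x y u
  rw [margSnd_mixtureJoint hP hQ]
  simp only [mixtureJoint, ← Finset.mul_sum, ← Finset.sum_mul, (hP u).2, (hQ u).2]
  ring

variable [Fintype U]

lemma mixtureJoint_mem (hw : w ∈ stdSimplex ℝ U) (hP : ∀ u, P u ∈ stdSimplex ℝ X)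
    (hQ : ∀ u, Q u ∈ stdSimplex ℝ Y) : mixtureJoint w P Q ∈ stdSimplex ℝ ((X × Y) × U) := by
  refine ⟨fun z => mul_nonneg (hw.1 _) (mul_nonneg ((hP _).1 _) ((hQ _).1 _)), ?_⟩
  rw [Fintype.sum_prod_type_right, ← hw.2]
  exact Finset.sum_congr rfl fun u _ => margSnd_mixtureJoint hP hQ u

lemma ne_zero_of_mixture_term_ne_zero (hw : w ∈ stdSimplex ℝ U) (hP : ∀ u, P u ∈ stdSimplex ℝ X)
    (hQ : ∀ u, Q u ∈ stdSimplex ℝ Y) {q : X × Y → ℝ}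
    (hq : ∀ z, ∑ u, w u * (P u z.1 * Q u z.2) = q z) {u : U} {z : X × Y}
    (h0 : w u * (P u z.1 * Q u z.2) ≠ 0) : q z ≠ 0 := by
  have hnn : ∀ u, 0 ≤ w u * (P u z.1 * Q u z.2) := fun u =>
    mul_nonneg (hw.1 _) (mul_nonneg ((hP _).1 _) ((hQ _).1 _))
  have := Finset.single_le_sum (fun i _ => hnn i) (Finset.mem_univ u)
  rw [hq z] at this
  exact ((lt_of_le_of_ne (hnn u) (Ne.symm h0)).trans_le this).ne'

lemma sum_mul_log_mixture (hw : w ∈ stdSimplex ℝ U) (hP : ∀ u, P u ∈ stdSimplex ℝ X)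
    (hQ : ∀ u, Q u ∈ stdSimplex ℝ Y) {q : X × Y → ℝ}
    (hq : ∀ z, ∑ u, w u * (P u z.1 * Q u z.2) = q z) :
    ∑ z : X × Y, ∑ u, w u * (P u z.1 * Q u z.2) * log (P u z.1 * Q u z.2 / q z) =
      entropy q - ∑ u, w u * (entropy (P u) + entropy (Q u)) := by
  have hterm : ∀ (z : X × Y) u, w u * (P u z.1 * Q u z.2) * log (P u z.1 * Q u z.2 / q z) =
      -(w u * negMulLog (P u z.1 * Q u z.2)) + w u * (P u z.1 * Q u z.2) * -log (q z) := by
    intro z u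
    rcases eq_or_ne (w u * (P u z.1 * Q u z.2)) 0 with h0 | h0
    · rw [h0]
      rcases mul_eq_zero.1 h0 with h | h <;> simp [h]
    · rw [log_div (right_ne_zero_of_mul h0) (ne_zero_of_mixture_term_ne_zero hw hP hQ hq h0),
        negMulLog]
      ring
  simp only [hterm, Finset.sum_add_distrib, ← Finset.sum_mul, hq]
  rw [Finset.sum_comm, add_comm, sub_eq_add_neg]
  congr 1
  · exact Finset.sum_congr rfl fun z _ => by rw [negMulLog]; ring
  · rw [← Finset.sum_neg_distrib]
    refine Finset.sum_congr rfl fun u _ => ?_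
    rw [Finset.sum_neg_distrib, ← Finset.mul_sum, ← entropy_prod (hP u).2 (hQ u).2, entropy]

/-- I(X,Y;U) = H(X,Y) - H(X,Y|U), and conditional independence splits the last entropy. Dividing by
`log 2` turns nats into bits. -/
lemma mutualInfo_mixtureJoint (hw : w ∈ stdSimplex ℝ U) (hP : ∀ u, P u ∈ stdSimplex ℝ X)
    (hQ : ∀ u, Q u ∈ stdSimplex ℝ Y) {q : X × Y → ℝ}
    (hq : ∀ z, ∑ u, w u * (P u z.1 * Q u z.2) = q z) :
    mutualInfo (mixtureJoint w P Q) =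
      (entropy q - ∑ u, w u * (entropy (P u) + entropy (Q u))) / log 2 := by
  have hF : ∀ z, margFst (mixtureJoint w P Q) z = q z := hq
  unfold mutualInfo
  simp only [hF, margSnd_mixtureJoint hP hQ, logb, ← mul_div_assoc, ← Finset.sum_div]
  rw [← sum_mul_log_mixture hw hP hQ hq]
  congr 1
  refine Finset.sum_congr rfl fun z _ => Finset.sum_congr rfl fun u _ => ?_
  rw [mixtureJoint, mul_comm (q z)]
  rcases eq_or_ne (w u) 0 with h | h
  · simp [h]
  · rw [mul_div_mul_left _ _ h]

/-- Conditioning reduces entropy: Gibbs' inequality for each component against `q`, then averaging.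
It gives C ≥ 0, so rates above C are nonnegative. -/
lemma sum_entropy_le_entropy_mixture (hw : w ∈ stdSimplex ℝ U) (hP : ∀ u, P u ∈ stdSimplex ℝ X)
    (hQ : ∀ u, Q u ∈ stdSimplex ℝ Y) {q : X × Y → ℝ} (hqm : q ∈ stdSimplex ℝ (X × Y))
    (hq : ∀ z, ∑ u, w u * (P u z.1 * Q u z.2) = q z) :
    ∑ u, w u * (entropy (P u) + entropy (Q u)) ≤ entropy q := by
  have h : ∀ u, w u * (entropy (P u) + entropy (Q u)) ≤
      w u * ∑ z : X × Y, P u z.1 * Q u z.2 * -log (q z) := by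
    intro u
    rcases eq_or_ne (w u) 0 with h | h
    · simp [h]
    · rw [← entropy_prod (hP u).2 (hQ u).2]
      exact mul_le_mul_of_nonneg_left (entropy_le_cross (prod_mem_stdSimplex (hP u) (hQ u)) hqm.1
        hqm.2.le fun z hz => ne_zero_of_mixture_term_ne_zero hw hP hQ hq (mul_ne_zero h hz))
        (hw.1 u)
  refine (Finset.sum_le_sum fun u _ => h u).trans_eq ?_
  simp only [Finset.mul_sum, ← mul_assoc]
  rw [Finset.sum_comm]
  refine Finset.sum_congr rfl fun z _ => ?_
  rw [← Finset.sum_mul, negMulLog, neg_mul, ← mul_neg, ← hq z]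
  simp only [mul_assoc]

end mixtureJoint

lemma IsMarkov.exists_eq_mixtureJoint {X Y U : Type*} [Fintype X] [Fintype Y] [Fintype U]
    {p : (X × Y) × U → ℝ} (hp : p ∈ stdSimplex ℝ ((X × Y) × U)) (hM : IsMarkov p) :
    ∃ (P : U → X → ℝ) (Q : U → Y → ℝ), (∀ u, P u ∈ stdSimplex ℝ X) ∧
      (∀ u, Q u ∈ stdSimplex ℝ Y) ∧ p = mixtureJoint (margSnd p) P Q := by
  classical
  have : Nonempty ((X × Y) × U) := by
    by_contra h
    rw [not_nonempty_iff] at h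
    simpa using hp.2
  obtain ⟨⟨x₀, y₀⟩, -⟩ := this
  have hw0 : ∀ u, 0 ≤ margSnd p u := fun u => Finset.sum_nonneg fun z _ => hp.1 _
  -- The conditional laws given `u`; for `u` of probability zero an arbitrary point mass is used.
  refine ⟨fun u => if margSnd p u = 0 then Pi.single x₀ 1 else
      fun x => (∑ y, p ((x, y), u)) / margSnd p u,
    fun u => if margSnd p u = 0 then Pi.single y₀ 1 else
      fun y => (∑ x, p ((x, y), u)) / margSnd p u, fun u => ?_, fun u => ?_, ?_⟩
  · beta_reduce
    split_ifs with h
    · exact single_mem_stdSimplex ℝ x₀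
    · refine ⟨fun x => div_nonneg (Finset.sum_nonneg fun _ _ => hp.1 _) (hw0 u), ?_⟩
      rw [← Finset.sum_div, ← Fintype.sum_prod_type fun z : X × Y => p (z, u)]
      exact div_self h
  · beta_reduce
    split_ifs with h
    · exact single_mem_stdSimplex ℝ y₀
    · refine ⟨fun x => div_nonneg (Finset.sum_nonneg fun _ _ => hp.1 _) (hw0 u), ?_⟩
      rw [← Finset.sum_div, ← Fintype.sum_prod_type_right fun z : X × Y => p (z, u)]
      exact div_self h
  · ext ⟨⟨x, y⟩, u⟩
    simp only [mixtureJoint]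
    split_ifs with h
    · rw [h, zero_mul]
      exact (Finset.sum_eq_zero_iff_of_nonneg fun z _ => hp.1 (z, u)).1 h (x, y) (Finset.mem_univ _)
    · have := hM x y u
      field_simp
      linarith

/-- Trades auxiliary alphabets of unbounded size for a slice of one compact set. -/
lemma mem_wynerValues_iff {X Y : Type*} [Fintype X] [Fintype Y] {q : X × Y → ℝ} {I : ℝ} :
    I ∈ wynerValues q ↔
      ∃ t, (q, t) ∈ convexHull ℝ (productPoints X Y) ∧ I = (entropy q - t) / log 2 := by
  constructor
  · rintro ⟨k, p, hp, hq, hM, rfl⟩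
    have hw : margSnd p ∈ stdSimplex ℝ (Fin k) :=
      ⟨fun u => Finset.sum_nonneg fun z _ => hp.1 _, by
        rw [← hp.2, Fintype.sum_prod_type_right]; rfl⟩
    obtain ⟨P, Q, hP, hQ, h⟩ := hM.exists_eq_mixtureJoint hp
    have hq' : ∀ z, ∑ u, margSnd p u * (P u z.1 * Q u z.2) = q z := by
      intro z
      rw [← hq z]
      conv_rhs => rw [h]
      rfl
    refine ⟨_, ?_, (congrArg mutualInfo h).trans (mutualInfo_mixtureJoint hw hP hQ hq')⟩
    have := mixture_mem_convexHull hw hP hQ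
    rwa [funext hq'] at this
  · rintro ⟨t, ht, rfl⟩
    obtain ⟨k, w, P, Q, hw, hP, hQ, hq, rfl⟩ := exists_mixture_of_mem_convexHull ht
    exact ⟨k, mixtureJoint w P Q, mixtureJoint_mem hw hP hQ, hq, isMarkov_mixtureJoint hP hQ,
      (mutualInfo_mixtureJoint hw hP hQ hq).symm⟩

lemma isLeast_wynerCommonInfo {X Y : Type*} [Fintype X] [Fintype Y] {q : X × Y → ℝ}
    (hq : q ∈ stdSimplex ℝ (X × Y)) : IsLeast (wynerValues q) (wynerCommonInfo q) := by
  classical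
  have hK := isCompact_convexHull_productPoints X Y
  have hne : ∃ t, (q, t) ∈ convexHull ℝ (productPoints X Y) := by
    -- The choice U = (X,Y) is always admissible, so the slice over `q` is nonempty.
    have := mixture_mem_convexHull (P := fun u : X × Y => Pi.single u.1 1)
      (Q := fun u : X × Y => Pi.single u.2 1) hq (fun u => single_mem_stdSimplex ℝ _)
      (fun u => single_mem_stdSimplex ℝ _)
    have he : (fun z : X × Y => ∑ u : X × Y, q u * ((Pi.single u.1 1 : X → ℝ) z.1 *
        (Pi.single u.2 1 : Y → ℝ) z.2)) = q := by
      ext ⟨x, y⟩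
      rw [Finset.sum_eq_single (x, y)]
      · simp
      · rintro ⟨x', y'⟩ - h
        by_cases h1 : x = x' <;> by_cases h2 : y = y' <;> simp_all [Pi.single_apply]
      · simp
    exact ⟨_, he ▸ this⟩
  have hT : IsCompact (convexHull ℝ (productPoints X Y) ∩ {z | z.1 = q}) :=
    hK.inter_right (isClosed_eq continuous_fst continuous_const)
  obtain ⟨t₀, ht₀⟩ := hne
  obtain ⟨⟨q', t⟩, ⟨ht, rfl⟩, hmax⟩ :=
    hT.exists_isMaxOn ⟨(q, t₀), ht₀, rfl⟩ continuous_snd.continuousOn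
  have hl : IsLeast (wynerValues q') ((entropy q' - t) / log 2) := by
    refine ⟨mem_wynerValues_iff.2 ⟨t, ht, rfl⟩, ?_⟩
    intro I hI
    obtain ⟨s, hs, rfl⟩ := mem_wynerValues_iff.1 hI
    have h1 : s ≤ t := hmax (show (q', s) ∈ _ from ⟨hs, rfl⟩)
    have h2 : 0 < log 2 := log_pos one_lt_two
    gcongr
  rw [wynerCommonInfo, hl.csInf_eq]
  exact hl

/-! ### Converse: lower bound on the rates. -/

section Converse

variable {X Y U : Type*} [Fintype X] [Fintype Y] [Fintype U]

/-- Single-letterization: the new auxiliary variable is (u, i) with `i` a uniform time index, and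
its component laws are the `i`-th marginals. Subadditivity of entropy bounds the block entropies by
sums over the coordinates. -/
lemma exists_mem_convexHull_of_mixture {n : ℕ} (hn : 0 < n) {w : U → ℝ}
    {P : U → (Fin n → X) → ℝ} {Q : U → (Fin n → Y) → ℝ} (hw : w ∈ stdSimplex ℝ U)
    (hP : ∀ u, P u ∈ stdSimplex ℝ (Fin n → X)) (hQ : ∀ u, Q u ∈ stdSimplex ℝ (Fin n → Y))
    {p : (Fin n → X) × (Fin n → Y) → ℝ} (hp : ∀ z, p z = ∑ u, w u * (P u z.1 * Q u z.2)) :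
    ∃ (r : X × Y → ℝ) (t : ℝ), (r, t) ∈ convexHull ℝ (productPoints X Y) ∧
      (∀ z, r z = (∑ i, pushforward (Prod.map (fun x : Fin n → X => x i)
        (fun y : Fin n → Y => y i)) p z) / n) ∧
      entropy p ≤ log (Fintype.card U) + n * t := by
  have hn0 : (n : ℝ) ≠ 0 := by positivity
  have hw' : (fun ui : U × Fin n => w ui.1 / n) ∈ stdSimplex ℝ (U × Fin n) := by
    refine ⟨fun ui => div_nonneg (hw.1 _) (by positivity), ?_⟩
    rw [Fintype.sum_prod_type]
    simp only [Finset.sum_const, Finset.card_univ, Fintype.card_fin, nsmul_eq_mul]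
    simp only [mul_div_cancel₀ _ hn0, hw.2]
  refine ⟨_, _, mixture_mem_convexHull hw'
    (P := fun ui => pushforward (fun x : Fin n → X => x ui.2) (P ui.1))
    (Q := fun ui => pushforward (fun x : Fin n → Y => x ui.2) (Q ui.1))
    (fun ui => pushforward_mem _ (hP _)) (fun ui => pushforward_mem _ (hQ _)), ?_, ?_⟩
  · intro z
    rw [funext hp, Fintype.sum_prod_type_right, Finset.sum_div]
    refine Finset.sum_congr rfl fun i _ => ?_
    rw [pushforward_sum_smul _ w (fun u (z : (Fin n → X) × (Fin n → Y)) => P u z.1 * Q u z.2),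
      Finset.sum_div]
    refine Finset.sum_congr rfl fun u _ => ?_
    rw [pushforward_prodMap]
    ring
  · rw [funext hp]
    refine (entropy_mixture_le hw fun u => prod_mem_stdSimplex (hP u) (hQ u)).trans ?_
    rw [Fintype.sum_prod_type, Finset.mul_sum]
    refine add_le_add le_rfl (Finset.sum_le_sum fun u _ => ?_)
    rw [entropy_prod (hP u).2 (hQ u).2, Finset.mul_sum]
    calc w u * (entropy (P u) + entropy (Q u))
        ≤ w u * (∑ i, entropy (pushforward (fun x : Fin n → X => x i) (P u)) +
            ∑ i, entropy (pushforward (fun x : Fin n → Y => x i) (Q u))) := by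
          have := hw.1 u
          gcongr
          · exact entropy_le_sum_entropy_coord (hP u)
          · exact entropy_le_sum_entropy_coord (hQ u)
      _ = _ := by
          rw [← Finset.sum_add_distrib, Finset.mul_sum]
          refine Finset.sum_congr rfl fun i _ => ?_
          field_simp

lemma one_le_numIdx (n : ℕ) {R : ℝ} (hR : 0 ≤ R) : 1 ≤ numIdx n R :=
  Nat.le_floor (by simpa using one_le_rpow one_le_two (by positivity))

lemma log_numIdx_le (n : ℕ) {R : ℝ} (hR : 0 ≤ R) : log (numIdx n R) ≤ n * R * log 2 := by
  have h1 : (1 : ℝ) ≤ numIdx n R := by exact_mod_cast one_le_numIdx n hR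
  rw [← log_rpow two_pos]
  exact log_le_log (by linarith) (Nat.floor_le (by positivity))

lemma exists_mem_convexHull_of_simCode {q : X × Y → ℝ} (hq : q ∈ stdSimplex ℝ (X × Y))
    {n : ℕ} (hn : 0 < n) {R R₁ R₂ : ℝ} (hR : 0 ≤ R) (hR₁ : 0 ≤ R₁) (hR₂ : 0 ≤ R₂)
    (c : SimCode X Y n R R₁ R₂) :
    ∃ (r : X × Y → ℝ) (t : ℝ), (r, t) ∈ convexHull ℝ (productPoints X Y) ∧
      (∀ z, |r z - q z| ≤ 2 * tvDist c.induced (iidPMF q n)) ∧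
      entropy q - (R + R₁ + R₂) * log 2 - (2 * tvDist c.induced (iidPMF q n)) *
        (log (Fintype.card X) + log (Fintype.card Y) + 1) - 1 / n ≤ t := by
  have hn' : (0 : ℝ) < n := by exact_mod_cast hn
  have hn1 : (1 : ℝ) ≤ n := by exact_mod_cast hn
  have hN := one_le_numIdx n hR
  have hN₁ := one_le_numIdx n hR₁
  have hN₂ := one_le_numIdx n hR₂
  have hN₁' : (numIdx n R₁ : ℝ) ≠ 0 := by positivity
  have hN₂' : (numIdx n R₂ : ℝ) ≠ 0 := by positivity
  -- Shared randomness and message together serve as the auxiliary variable; the log of the size of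
  -- `V` is at most n(R + R₁ + R₂) log 2.
  let V := Fin (numIdx n R₁) × Fin (numIdx n R₂) × Fin (numIdx n R)
  let w : V → ℝ := fun u => c.enc u.1 u.2.1 u.2.2 / ((numIdx n R₁ : ℝ) * (numIdx n R₂ : ℝ))
  have hw : w ∈ stdSimplex ℝ V := by
    refine ⟨fun u => div_nonneg ((c.enc_mem _ _).1 _) (by positivity), ?_⟩
    simp only [w, V, Fintype.sum_prod_type, ← Finset.sum_div, (c.enc_mem _ _).2,
      Finset.sum_const, Finset.card_univ, Fintype.card_fin, nsmul_eq_mul]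
    field_simp
  have hp : ∀ z, c.induced z = ∑ u : V, w u * (c.dec₁ u.2.2 u.1 z.1 * c.dec₂ u.2.2 u.2.1 z.2) := by
    intro z
    simp only [SimCode.induced, SimCode.joint, w, V, Fintype.sum_prod_type]
    refine Finset.sum_congr rfl fun _ _ => Finset.sum_congr rfl fun _ _ =>
      Finset.sum_congr rfl fun _ _ => ?_
    ring
  have hT : 2 * tvDist c.induced (iidPMF q n) = ∑ z, |c.induced z - iidPMF q n z| := by
    rw [tvDist, ← Finset.mul_sum]
    ring
  have hpm : c.induced ∈ stdSimplex ℝ ((Fin n → X) × (Fin n → Y)) := by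
    rw [funext hp]
    exact mixture_mem_stdSimplex hw fun u => prod_mem_stdSimplex (c.dec₁_mem _ _) (c.dec₂_mem _ _)
  obtain ⟨r, t, hrt, hr, ht⟩ := exists_mem_convexHull_of_mixture hn hw
    (P := fun u => c.dec₁ u.2.2 u.1) (Q := fun u => c.dec₂ u.2.2 u.2.1)
    (fun u => c.dec₁_mem _ _) (fun u => c.dec₂_mem _ _) hp
  refine ⟨r, t, hrt, fun z => ?_, ?_⟩
  · have h1 : r z - q z = (∑ i, (pushforward (Prod.map (fun x : Fin n → X => x i)
        (fun y : Fin n → Y => y i)) c.induced z - q z)) / n := by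
      rw [hr, Finset.sum_sub_distrib]
      simp
      field_simp
    rw [h1, abs_div, abs_of_pos hn', div_le_iff₀ hn', hT]
    refine (Finset.abs_sum_le_sum_abs _ _).trans ((Finset.sum_le_card_nsmul _ _
      (∑ z, |c.induced z - iidPMF q n z|) fun i _ => ?_).trans_eq ?_)
    · rw [← pushforward_iidPMF hq i z]
      exact abs_pushforward_sub_le _ _ _ _
    · simp [mul_comm]
  · have h1 := entropy_sub_le hpm (iidPMF_mem hq n)
    rw [entropy_iidPMF hq, ← hT] at h1
    have hc : log (Fintype.card ((Fin n → X) × (Fin n → Y)) : ℕ) =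
        n * (log (Fintype.card X) + log (Fintype.card Y)) := by
      have : Nonempty (X × Y) := by
        by_contra h
        rw [not_nonempty_iff] at h
        simpa using hq.2
      obtain ⟨x₀, y₀⟩ := this
      have hX : (Fintype.card X : ℝ) ≠ 0 := by
        have : Nonempty X := ⟨x₀⟩
        simp
      have hY : (Fintype.card Y : ℝ) ≠ 0 := by
        have : Nonempty Y := ⟨y₀⟩
        simp
      simp only [Fintype.card_prod, Fintype.card_fun, Fintype.card_fin]
      push_cast
      rw [log_mul (pow_ne_zero _ hX) (pow_ne_zero _ hY), log_pow, log_pow]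
      ring
    have hcV : log (Fintype.card V) ≤ n * ((R + R₁ + R₂) * log 2) := by
      simp only [V, Fintype.card_prod, Fintype.card_fin]
      push_cast
      rw [log_mul hN₁' (by positivity), log_mul hN₂' (by positivity)]
      linarith [log_numIdx_le n hR, log_numIdx_le n hR₁, log_numIdx_le n hR₂]
    rw [hc] at h1
    have hτ : 0 ≤ 2 * tvDist c.induced (iidPMF q n) :=
      hT ▸ Finset.sum_nonneg fun _ _ => abs_nonneg _
    refine le_of_mul_le_mul_left (a := (n : ℝ)) ?_ hn'
    have h2 : (n : ℝ) * (1 / n) = 1 := by field_simp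
    -- The continuity bound carries a term τ not multiplied by n; bounding it by nτ explains the `+
    -- 1` beside the log-cardinalities.
    have h3 := mul_le_mul_of_nonneg_left hn1 hτ
    nlinarith

lemma Achievable.wynerCommonInfo_le {q : X × Y → ℝ} (hq : q ∈ stdSimplex ℝ (X × Y))
    {R R₁ R₂ : ℝ} (h : Achievable q R R₁ R₂) : wynerCommonInfo q ≤ R + R₁ + R₂ := by
  obtain ⟨hR, hR₁, hR₂, c, hc⟩ := h
  -- Blocklengths are shifted by one since time averaging needs n > 0.
  choose r t hK hr ht using fun n : ℕ =>
    exists_mem_convexHull_of_simCode hq n.succ_pos hR hR₁ hR₂ (c (n + 1))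
  obtain ⟨⟨r', t'⟩, hK', φ, hφ, hlim⟩ :=
    (isCompact_convexHull_productPoints X Y).tendsto_subseq hK
  have hτ : Tendsto (fun n => 2 * tvDist (c (n + 1)).induced (iidPMF q (n + 1))) atTop
      (nhds 0) := by
    simpa using (hc.comp (tendsto_add_atTop_nat 1)).const_mul 2
  have hrq : r' = q := by
    ext z
    have h1 : Tendsto (fun n => r (φ n) z) atTop (nhds (r' z)) :=
      ((continuous_apply z).comp continuous_fst).continuousAt.tendsto.comp hlim
    refine tendsto_nhds_unique h1 ?_
    have h2 : Tendsto (fun n => r n z) atTop (nhds (q z)) :=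
      tendsto_iff_dist_tendsto_zero.2 (squeeze_zero (fun _ => dist_nonneg) (fun n => hr n z) hτ)
    exact h2.comp hφ.tendsto_atTop
  have ht' : entropy q - (R + R₁ + R₂) * log 2 ≤ t' := by
    have h1 : Tendsto (fun n => t (φ n)) atTop (nhds t') :=
      continuous_snd.continuousAt.tendsto.comp hlim
    have h2 := ((tendsto_const_nhds (x := entropy q - (R + R₁ + R₂) * log 2)).sub
      (hτ.mul_const (log (Fintype.card X) + log (Fintype.card Y) + 1))).sub
      (tendsto_one_div_add_atTop_nhds_zero_nat (𝕜 := ℝ))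
    simp only [zero_mul, sub_zero] at h2
    refine le_of_tendsto_of_tendsto' (h2.comp hφ.tendsto_atTop) h1 fun n => ?_
    have := ht (φ n)
    push_cast at this
    exact this
  subst hrq
  have hlog : 0 < log 2 := log_pos one_lt_two
  refine ((isLeast_wynerCommonInfo hq).2 (mem_wynerValues_iff.2 ⟨t', hK', rfl⟩)).trans ?_
  rw [div_le_iff₀ hlog]
  linarith

/-- A point (R, 0, 0) of the closure may be a limit of triplets with positive shared randomness, so
the bound must hold for all three rates. -/
lemma wynerCommonInfo_le_of_mem_rateRegion {q : X × Y → ℝ} (hq : q ∈ stdSimplex ℝ (X × Y))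
    {r : ℝ × ℝ × ℝ} (hr : r ∈ rateRegion q) : wynerCommonInfo q ≤ r.1 + r.2.1 + r.2.2 := by
  have hcl : IsClosed {r : ℝ × ℝ × ℝ | wynerCommonInfo q ≤ r.1 + r.2.1 + r.2.2} :=
    isClosed_le continuous_const (by fun_prop)
  exact hcl.closure_subset_iff.2 (fun r hr => Achievable.wynerCommonInfo_le hq hr) hr

end Converse

/-! ### Soft covering by a random codebook. -/

section SoftCovering

variable {A Z : Type*} [Fintype A] [Fintype Z]

lemma sum_pi_succ {N : ℕ} (F : (Fin (N + 1) → A) → ℝ) :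
    ∑ c, F c = ∑ a, ∑ c : Fin N → A, F (Fin.cons a c) := by
  rw [← (Fin.consEquiv fun _ : Fin (N + 1) => A).sum_comp, Fintype.sum_prod_type]
  rfl

lemma sum_codebook_linear {ρ : A → ℝ} (hρ : ∑ a, ρ a = 1) (g : A → ℝ) (N : ℕ) :
    ∑ c : Fin N → A, (∏ i, ρ (c i)) * ∑ i, g (c i) = N * ∑ a, ρ a * g a := by
  classical
  induction N with
  | zero => simp
  | succ N ih =>
    have h1 : ∑ c : Fin N → A, ∏ i, ρ (c i) = 1 := by
      rw [← Fintype.sum_pow, hρ, one_pow]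
    have h : ∀ (a : A) (c : Fin N → A), ρ a * (∏ i, ρ (c i)) * (g a + ∑ i, g (c i)) =
        ρ a * g a * (∏ i, ρ (c i)) + ρ a * ((∏ i, ρ (c i)) * ∑ i, g (c i)) := fun a c => by ring
    rw [sum_pi_succ]
    simp only [Fin.prod_univ_succ, Fin.sum_univ_succ, Fin.cons_zero, Fin.cons_succ, h,
      Finset.sum_add_distrib, ← Finset.mul_sum, h1, ih, ← Finset.sum_mul, hρ]
    push_cast
    ring

/-- Variance of a sum of independent centred terms: splitting off one codeword at a time, the cross
terms vanish. -/
lemma sum_codebook_sq {ρ : A → ℝ} (hρ : ∑ a, ρ a = 1) {g : A → ℝ} (hg : ∑ a, ρ a * g a = 0)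
    (N : ℕ) :
    ∑ c : Fin N → A, (∏ i, ρ (c i)) * (∑ i, g (c i)) ^ 2 = N * ∑ a, ρ a * g a ^ 2 := by
  classical
  induction N with
  | zero => simp
  | succ N ih =>
    have h1 : ∑ c : Fin N → A, ∏ i, ρ (c i) = 1 := by
      rw [← Fintype.sum_pow, hρ, one_pow]
    have h : ∀ (a : A) (c : Fin N → A), ρ a * (∏ i, ρ (c i)) * (g a + ∑ i, g (c i)) ^ 2 =
        ρ a * g a ^ 2 * (∏ i, ρ (c i)) + ρ a * (2 * g a) * ((∏ i, ρ (c i)) * ∑ i, g (c i)) +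
          ρ a * ((∏ i, ρ (c i)) * (∑ i, g (c i)) ^ 2) := fun a c => by ring
    rw [sum_pi_succ]
    simp only [Fin.prod_univ_succ, Fin.sum_univ_succ, Fin.cons_zero, Fin.cons_succ, h,
      Finset.sum_add_distrib, ← Finset.mul_sum, h1, ih, ← Finset.sum_mul, hρ,
      sum_codebook_linear hρ, hg]
    push_cast
    ring

/-- Expected deviation of the empirical mean of `N` i.i.d. samples. -/
lemma sum_codebook_abs_le {ρ : A → ℝ} (hρ : ρ ∈ stdSimplex ℝ A) {N : ℕ} (hN : 0 < N)
    {f : A → ℝ} {V : ℝ} (hV : ∑ a, ρ a * f a ^ 2 ≤ V) :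
    ∑ c : Fin N → A, (∏ i, ρ (c i)) * |(∑ i, f (c i)) / N - ∑ a, ρ a * f a| ≤ √(V / N) := by
  have hN' : (0 : ℝ) < N := by exact_mod_cast hN
  have hc := pi_mem_stdSimplex (n := N) fun _ => hρ
  set μ := ∑ a, ρ a * f a with hμ
  have hg : ∑ a, ρ a * (f a - μ) = 0 := by
    simp only [mul_sub, Finset.sum_sub_distrib, ← Finset.sum_mul, hρ.2, ← hμ]
    ring
  have hvar : ∑ a, ρ a * (f a - μ) ^ 2 ≤ V := by
    have h : ∀ a, ρ a * (f a - μ) ^ 2 = ρ a * f a ^ 2 - 2 * μ * (ρ a * f a) + μ ^ 2 * ρ a :=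
      fun a => by ring
    simp only [h, Finset.sum_add_distrib, Finset.sum_sub_distrib, ← Finset.mul_sum, hρ.2, ← hμ]
    nlinarith [sq_nonneg μ]
  have hdev : ∀ c : Fin N → A, (∑ i, f (c i)) / N - μ = (∑ i, (f (c i) - μ)) / N := by
    intro c
    simp only [Finset.sum_sub_distrib, Finset.sum_const, Finset.card_univ, Fintype.card_fin,
      nsmul_eq_mul]
    field_simp
  -- Jensen: the squared mean deviation is at most the variance of the empirical mean.
  refine le_sqrt_of_sq_le ((pow_arith_mean_le_arith_mean_pow_of_even Finset.univ _ _
    (fun c _ => hc.1 c) hc.2 even_two).trans ?_)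
  simp only [sq_abs, hdev, div_pow, ← mul_div_assoc, ← Finset.sum_div,
    sum_codebook_sq hρ.2 hg N]
  rw [div_le_div_iff₀ (by positivity) hN']
  nlinarith [mul_le_mul_of_nonneg_left hvar (mul_pos hN' hN').le]

lemma exists_le_of_weighted_sum_le {C : Type*} [Fintype C] {w : C → ℝ}
    (hw : w ∈ stdSimplex ℝ C) {D : C → ℝ} {B : ℝ} (h : ∑ c, w c * D c ≤ B) : ∃ c, D c ≤ B := by
  by_contra! hB
  obtain ⟨c, -, hc⟩ := Finset.exists_ne_zero_of_sum_ne_zero (hw.2.trans_ne one_ne_zero)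
  have hpos : 0 < ∑ c, w c * (D c - B) :=
    Finset.sum_pos' (fun c _ => mul_nonneg (hw.1 c) (sub_nonneg.2 (hB c).le))
      ⟨c, Finset.mem_univ c, mul_pos (lt_of_le_of_ne (hw.1 c) hc.symm) (sub_pos.2 (hB c))⟩
  simp only [mul_sub, Finset.sum_sub_distrib, ← Finset.sum_mul, hw.2] at hpos
  linarith

open Classical in
/-- One-shot soft covering lemma. -/
lemma exists_codebook {ρ : A → ℝ} (hρ : ρ ∈ stdSimplex ℝ A) {W : A → Z → ℝ}
    (hW : ∀ a, W a ∈ stdSimplex ℝ Z) {r : Z → ℝ} (hr : ∀ z, r z = ∑ a, ρ a * W a z)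
    {N : ℕ} (hN : 0 < N) {T : ℝ} (hT : 0 ≤ T) :
    ∃ c : Fin N → A, ∑ z, |(∑ m, W (c m) z) / N - r z| ≤
      √(T / N) + 2 * ∑ z, ∑ a, ρ a * (if T * r z < W a z then W a z else 0) := by
  have hN' : (0 : ℝ) < N := by exact_mod_cast hN
  have hc := pi_mem_stdSimplex (n := N) fun _ => hρ
  have hr1 : ∑ z, r z = 1 := by
    rw [funext hr]
    exact (mixture_mem_stdSimplex hρ hW).2
  have hr0 : ∀ z, 0 ≤ r z := fun z =>
    hr z ▸ Finset.sum_nonneg fun a _ => mul_nonneg (hρ.1 a) ((hW a).1 z)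
  -- Truncation: `h` is the atypical part of the channel and the remainder `f` is at most `T * r`.
  -- Hence `f` has second moment at most `T * r ^ 2` and mean deviation at most `r * √(T / N)`,
  -- which sums over `z` to `√(T / N)`.
  set h : A → Z → ℝ := fun a z => if T * r z < W a z then W a z else 0 with hh
  have hh0 : ∀ a z, 0 ≤ h a z := fun a z => by
    simp only [hh]; split_ifs <;> simp [(hW a).1 z]
  set f : A → Z → ℝ := fun a z => W a z - h a z with hf
  have hf0 : ∀ a z, 0 ≤ f a z := fun a z => by
    simp only [hf, hh]; split_ifs <;> simp [(hW a).1 z]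
  have hfT : ∀ a z, f a z ≤ T * r z := fun a z => by
    simp only [hf, hh]
    split_ifs with h1
    · simpa using mul_nonneg hT (hr0 z)
    · simpa using h1
  have hfW : ∀ a z, f a z ≤ W a z := fun a z => by simp [hf, hh0 a z]
  have hV : ∀ z, ∑ a, ρ a * f a z ^ 2 ≤ T * r z ^ 2 := by
    intro z
    calc ∑ a, ρ a * f a z ^ 2 ≤ ∑ a, T * r z * (ρ a * W a z) :=
          Finset.sum_le_sum fun a _ => by
            have := mul_le_mul (hfT a z) (hfW a z) (hf0 a z) (mul_nonneg hT (hr0 z))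
            nlinarith [hρ.1 a]
      _ = T * r z ^ 2 := by rw [← Finset.mul_sum, ← hr z]; ring
  refine exists_le_of_weighted_sum_le hc ?_
  -- The atypical part enters through the empirical mean and through the target, with equal
  -- expectations; hence the factor 2.
  have hpt : ∀ (c : Fin N → A) z, |(∑ m, W (c m) z) / N - r z| ≤
      |(∑ m, f (c m) z) / N - ∑ a, ρ a * f a z| + (∑ m, h (c m) z) / N + ∑ a, ρ a * h a z := by
    intro c z
    have e : (∑ m, W (c m) z) / N - r z = ((∑ m, f (c m) z) / N - ∑ a, ρ a * f a z) +
        (∑ m, h (c m) z) / N - ∑ a, ρ a * h a z := by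
      rw [hr z]
      simp only [hf, mul_sub, Finset.sum_sub_distrib]
      ring
    have h1 : 0 ≤ (∑ m, h (c m) z) / N := div_nonneg (Finset.sum_nonneg fun _ _ => hh0 _ _) hN'.le
    have h2 : 0 ≤ ∑ a, ρ a * h a z := Finset.sum_nonneg fun _ _ => mul_nonneg (hρ.1 _) (hh0 _ _)
    rw [e, abs_le]
    constructor
    · linarith [neg_abs_le ((∑ m, f (c m) z) / N - ∑ a, ρ a * f a z)]
    · linarith [le_abs_self ((∑ m, f (c m) z) / N - ∑ a, ρ a * f a z)]
  calc ∑ c : Fin N → A, (∏ i, ρ (c i)) * ∑ z, |(∑ m, W (c m) z) / N - r z|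
      ≤ ∑ c : Fin N → A, ∑ z, ((∏ i, ρ (c i)) * |(∑ m, f (c m) z) / N - ∑ a, ρ a * f a z| +
          (∏ i, ρ (c i)) * (∑ m, h (c m) z) / N + (∏ i, ρ (c i)) * ∑ a, ρ a * h a z) := by
        refine Finset.sum_le_sum fun c _ => ?_
        rw [Finset.mul_sum]
        refine Finset.sum_le_sum fun z _ => ?_
        refine (mul_le_mul_of_nonneg_left (hpt c z) (hc.1 c)).trans_eq ?_
        ring
    _ = ∑ z, (∑ c : Fin N → A, (∏ i, ρ (c i)) * |(∑ m, f (c m) z) / N - ∑ a, ρ a * f a z| +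
          2 * ∑ a, ρ a * h a z) := by
        rw [Finset.sum_comm]
        refine Finset.sum_congr rfl fun z _ => ?_
        have := sum_codebook_linear hρ.2 (fun a => h a z) N
        rw [Finset.sum_add_distrib, Finset.sum_add_distrib, ← Finset.sum_div, this,
          ← Finset.sum_mul, hc.2]
        field_simp
        ring
    _ ≤ ∑ z, (r z * √(T / N) + 2 * ∑ a, ρ a * h a z) := by
        refine Finset.sum_le_sum fun z _ => add_le_add ?_ le_rfl
        refine (sum_codebook_abs_le hρ hN (hV z)).trans_eq ?_
        rw [mul_comm T, mul_div_assoc, sqrt_mul (sq_nonneg _), sqrt_sq (hr0 z)]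
    _ = _ := by
        rw [Finset.sum_add_distrib, ← Finset.sum_mul, hr1, one_mul, ← Finset.mul_sum]

end SoftCovering

/-! ### Achievability above Wyner's common information. -/

section Achievability

variable {X Y U : Type*} [Fintype X] [Fintype Y] [Fintype U] {w : U → ℝ} {P : U → X → ℝ}
  {Q : U → Y → ℝ}

/-- As a function of `s` the sum equals 1 at 0 and has derivative I(X,Y;U) - L < 0 there (in nats),
so it drops below 1 just to the right of 0. -/
lemma exists_pos_sum_rpow_lt_one (hw : w ∈ stdSimplex ℝ U) (hP : ∀ u, P u ∈ stdSimplex ℝ X)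
    (hQ : ∀ u, Q u ∈ stdSimplex ℝ Y) {q : X × Y → ℝ}
    (hq : ∀ z, ∑ u, w u * (P u z.1 * Q u z.2) = q z) {L : ℝ}
    (hL : entropy q - ∑ u, w u * (entropy (P u) + entropy (Q u)) < L) :
    ∃ s : ℝ, 0 < s ∧ ∑ z : X × Y, ∑ u, w u * (P u z.1 * Q u z.2) *
      (P u z.1 * Q u z.2 / (exp L * q z)) ^ s < 1 := by
  have hqsum : ∑ z : X × Y, ∑ u, w u * (P u z.1 * Q u z.2) = 1 :=
    (mixture_mem_stdSimplex hw fun u => prod_mem_stdSimplex (hP u) (hQ u)).2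
  set F : ℝ → ℝ := fun s => ∑ z : X × Y, ∑ u, w u * (P u z.1 * Q u z.2) *
      (P u z.1 * Q u z.2 / (exp L * q z)) ^ s with hF
  have hF0 : F 0 = 1 := by simp only [hF, rpow_zero, mul_one, hqsum]
  have hd : HasDerivAt F (∑ z : X × Y, ∑ u, w u * (P u z.1 * Q u z.2) *
      (log (P u z.1 * Q u z.2 / q z) - L)) 0 := by
    refine HasDerivAt.fun_sum fun z _ => HasDerivAt.fun_sum fun u _ => ?_
    rcases eq_or_ne (w u * (P u z.1 * Q u z.2)) 0 with h0 | h0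
    · simp only [h0, zero_mul]
      exact hasDerivAt_const _ _
    · have hPQ : 0 < P u z.1 * Q u z.2 := lt_of_le_of_ne
        (mul_nonneg ((hP _).1 _) ((hQ _).1 _)) (right_ne_zero_of_mul h0).symm
      have hqz : q z ≠ 0 := ne_zero_of_mixture_term_ne_zero hw hP hQ hq h0
      have hqz0 : 0 < q z := lt_of_le_of_ne (hq z ▸ Finset.sum_nonneg fun u _ =>
        mul_nonneg (hw.1 u) (mul_nonneg ((hP _).1 _) ((hQ _).1 _))) hqz.symm
      have := ((hasStrictDerivAt_const_rpow (div_pos hPQ (mul_pos (exp_pos L) hqz0)) 0).hasDerivAt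
        ).const_mul (w u * (P u z.1 * Q u z.2))
      rw [rpow_zero, one_mul, mul_comm (exp L), ← div_div, log_div (div_pos hPQ hqz0).ne'
        (exp_pos L).ne', log_exp] at this
      rwa [mul_comm (exp L), ← div_div]
  have hneg : (∑ z : X × Y, ∑ u, w u * (P u z.1 * Q u z.2) *
      (log (P u z.1 * Q u z.2 / q z) - L)) < 0 := by
    simp only [mul_sub, Finset.sum_sub_distrib, ← Finset.sum_mul, hqsum]
    rw [sum_mul_log_mixture hw hP hQ hq]
    linarith
  have h1 := (hd.tendsto_slope.eventually (gt_mem_nhds hneg))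
  have h2 := (h1.filter_mono (nhdsWithin_mono (0 : ℝ) fun x (hx : x ∈ Set.Ioi (0 : ℝ)) =>
    (ne_of_gt hx : x ≠ 0))).and self_mem_nhdsWithin
  obtain ⟨s, hs, hs0 : 0 < s⟩ := h2.exists
  refine ⟨s, hs0, ?_⟩
  rw [slope_def_field, hF0, sub_zero, div_neg_iff] at hs
  rcases hs with hs | hs <;> [linarith [hs.2]; linarith [hs.1]]

lemma sum_pi_prod_eq_pow (n : ℕ) (F : U → X × Y → ℝ) :
    ∑ z : (Fin n → X) × (Fin n → Y), ∑ a : Fin n → U, ∏ i, F (a i) (z.1 i, z.2 i) =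
      (∑ z, ∑ u, F u z) ^ n := by
  classical
  rw [Fintype.sum_pow, ← (Equiv.arrowProdEquivProdArrow (Fin n) (fun _ => X) fun _ => Y).sum_comp]
  refine Finset.sum_congr rfl fun z _ => ?_
  rw [Fintype.prod_sum]
  rfl

open Classical in
/-- Chernoff bound on the probability that the information density is large. -/
lemma sum_atypical_le (hw : w ∈ stdSimplex ℝ U) (hP : ∀ u, P u ∈ stdSimplex ℝ X)
    (hQ : ∀ u, Q u ∈ stdSimplex ℝ Y) {q : X × Y → ℝ}
    (hq : ∀ z, ∑ u, w u * (P u z.1 * Q u z.2) = q z) (L : ℝ) {s : ℝ} (hs : 0 < s) (n : ℕ) :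
    ∑ z : (Fin n → X) × (Fin n → Y), ∑ a : Fin n → U, (∏ i, w (a i)) *
      (if exp L ^ n * iidPMF q n z < (∏ i, P (a i) (z.1 i)) * ∏ i, Q (a i) (z.2 i) then
        (∏ i, P (a i) (z.1 i)) * ∏ i, Q (a i) (z.2 i) else 0) ≤
      (∑ z : X × Y, ∑ u, w u * (P u z.1 * Q u z.2) *
        (P u z.1 * Q u z.2 / (exp L * q z)) ^ s) ^ n := by
  have hPQ0 : ∀ u (z : X × Y), 0 ≤ P u z.1 * Q u z.2 := fun u z =>
    mul_nonneg ((hP _).1 _) ((hQ _).1 _)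
  have hq0 : ∀ z, 0 ≤ q z := fun z =>
    hq z ▸ Finset.sum_nonneg fun u _ => mul_nonneg (hw.1 u) (hPQ0 u z)
  have hb0 : ∀ u z, 0 ≤ P u z.1 * Q u z.2 / (exp L * q z) := fun u z =>
    div_nonneg (hPQ0 u z) (mul_nonneg (exp_pos L).le (hq0 z))
  rw [← sum_pi_prod_eq_pow n fun u z => w u * (P u z.1 * Q u z.2) *
        (P u z.1 * Q u z.2 / (exp L * q z)) ^ s]
  refine Finset.sum_le_sum fun z _ => Finset.sum_le_sum fun a _ => ?_
  have hterm0 : ∀ i, 0 ≤ w (a i) * (P (a i) (z.1 i) * Q (a i) (z.2 i)) := fun i =>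
    mul_nonneg (hw.1 _) (hPQ0 (a i) (z.1 i, z.2 i))
  rw [Finset.prod_mul_distrib, finsetProd_rpow _ _ (fun i _ => hb0 (a i) (z.1 i, z.2 i))]
  have hrhs : 0 ≤ (∏ i, w (a i) * (P (a i) (z.1 i) * Q (a i) (z.2 i))) *
      (∏ i, P (a i) (z.1 i) * Q (a i) (z.2 i) / (exp L * q (z.1 i, z.2 i))) ^ s :=
    mul_nonneg (Finset.prod_nonneg fun i _ => hterm0 i)
      (rpow_nonneg (Finset.prod_nonneg fun i _ => hb0 (a i) (z.1 i, z.2 i)) _)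
  split_ifs with hlt
  swap
  · simpa using hrhs
  rw [← Finset.prod_mul_distrib, ← Finset.prod_mul_distrib]
  rcases eq_or_ne (∏ i, w (a i) * (P (a i) (z.1 i) * Q (a i) (z.2 i))) 0 with h0 | h0
  · rw [h0, zero_mul]
  -- Chernoff: on the atypical event the likelihood ratio is at least 1, hence so is its `s`-th
  -- power.
  · refine le_mul_of_one_le_right (Finset.prod_nonneg fun i _ => hterm0 i) (one_le_rpow ?_ hs.le)
    have hqi : ∀ i, 0 < q (z.1 i, z.2 i) := fun i => lt_of_le_of_ne (hq0 _)
      (ne_zero_of_mixture_term_ne_zero hw hP hQ hq (z := (z.1 i, z.2 i))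
        (Finset.prod_ne_zero_iff.1 h0 i (Finset.mem_univ i))).symm
    rw [Finset.prod_div_distrib, one_le_div (Finset.prod_pos fun i _ =>
      mul_pos (exp_pos L) (hqi i)), Finset.prod_mul_distrib, Finset.prod_mul_distrib]
    simpa [iidPMF] using hlt.le

lemma exists_codebook_of_mixture (hw : w ∈ stdSimplex ℝ U) (hP : ∀ u, P u ∈ stdSimplex ℝ X)
    (hQ : ∀ u, Q u ∈ stdSimplex ℝ Y) {q : X × Y → ℝ}
    (hq : ∀ z, ∑ u, w u * (P u z.1 * Q u z.2) = q z) (L : ℝ) {s : ℝ} (hs : 0 < s) (n : ℕ)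
    {N : ℕ} (hN : 0 < N) :
    ∃ c : Fin N → Fin n → U, ∑ z : (Fin n → X) × (Fin n → Y),
      |(∑ m, (∏ i, P (c m i) (z.1 i)) * ∏ i, Q (c m i) (z.2 i)) / N - iidPMF q n z| ≤
      √(exp L ^ n / N) + 2 * (∑ z : X × Y, ∑ u, w u * (P u z.1 * Q u z.2) *
        (P u z.1 * Q u z.2 / (exp L * q z)) ^ s) ^ n := by
  classical
  have hr : ∀ z, iidPMF q n z = ∑ a : Fin n → U, (∏ i, w (a i)) *
      ((∏ i, P (a i) (z.1 i)) * ∏ i, Q (a i) (z.2 i)) := by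
    intro z
    simp only [iidPMF, ← hq, ← Finset.prod_mul_distrib]
    rw [Fintype.prod_sum]
  obtain ⟨c, hc⟩ := exists_codebook (pi_mem_stdSimplex (n := n) fun _ => hw)
    (W := fun a (z : (Fin n → X) × (Fin n → Y)) =>
      (∏ i, P (a i) (z.1 i)) * ∏ i, Q (a i) (z.2 i))
    (fun a => prod_mem_stdSimplex (pi_mem_stdSimplex fun i => hP (a i))
      (pi_mem_stdSimplex fun i => hQ (a i))) hr hN (pow_nonneg (exp_pos L).le n)
  refine ⟨c, hc.trans ?_⟩
  gcongr
  exact sum_atypical_le hw hP hQ hq L hs n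

omit [Fintype U] in
lemma exists_simCode_of_codebook {n : ℕ} {R : ℝ} (hR : 0 ≤ R)
    (hP : ∀ u, P u ∈ stdSimplex ℝ X) (hQ : ∀ u, Q u ∈ stdSimplex ℝ Y)
    (c : Fin (numIdx n R) → Fin n → U) :
    ∃ C : SimCode X Y n R 0 0, ∀ z, C.induced z =
      (∑ m, (∏ i, P (c m i) (z.1 i)) * ∏ i, Q (c m i) (z.2 i)) / numIdx n R := by
  have hN := one_le_numIdx n hR
  have hN' : (numIdx n R : ℝ) ≠ 0 := by positivity
  refine ⟨{ enc := fun _ _ _ => (numIdx n R : ℝ)⁻¹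
            enc_mem := fun _ _ => ⟨fun _ => by positivity, by simp [hN']⟩
            dec₁ := fun m _ x => ∏ i, P (c m i) (x i)
            dec₁_mem := fun m _ => pi_mem_stdSimplex fun i => hP (c m i)
            dec₂ := fun m _ y => ∏ i, Q (c m i) (y i)
            dec₂_mem := fun m _ => pi_mem_stdSimplex fun i => hQ (c m i) }, fun z => ?_⟩
  -- At rate zero each shared index takes a single value, so averaging over it is trivial.
  have h0 : numIdx n 0 = 1 := by simp [numIdx]
  simp only [SimCode.induced, SimCode.joint, Finset.sum_const, Finset.card_univ, Fintype.card_fin,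
    h0, one_smul, Nat.cast_one, mul_one, div_one, Finset.sum_div]
  refine Finset.sum_congr rfl fun m _ => ?_
  ring

lemma wynerCommonInfo_nonneg {q : X × Y → ℝ} (hq : q ∈ stdSimplex ℝ (X × Y)) :
    0 ≤ wynerCommonInfo q := by
  obtain ⟨t, ht, hI⟩ := mem_wynerValues_iff.1 (isLeast_wynerCommonInfo hq).1
  obtain ⟨k, w, P, Q, hw, hP, hQ, hmix, rfl⟩ := exists_mixture_of_mem_convexHull ht
  rw [hI]
  exact div_nonneg (sub_nonneg.2 (sum_entropy_le_entropy_mixture hw hP hQ hq hmix))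
    (log_pos one_lt_two).le

/-- Rounding 2^{nR} ≥ 1 down to an integer loses at most a factor 2. -/
lemma inv_numIdx_le (n : ℕ) {R : ℝ} (hR : 0 ≤ R) :
    (numIdx n R : ℝ)⁻¹ ≤ 2 * (exp (R * log 2) ^ n)⁻¹ := by
  have h1 : (1 : ℝ) ≤ numIdx n R := by exact_mod_cast one_le_numIdx n hR
  have h2 : (2 : ℝ) ^ ((n : ℝ) * R) < numIdx n R + 1 := Nat.lt_floor_add_one _
  have h3 : (2 : ℝ) ^ ((n : ℝ) * R) = exp (R * log 2) ^ n := by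
    rw [rpow_def_of_pos two_pos, ← exp_nat_mul]
    ring_nf
  rw [h3] at h2
  have h4 : 0 < exp (R * log 2) ^ n := by positivity
  rw [← div_eq_mul_inv, inv_eq_one_div, div_le_div_iff₀ (by linarith) h4]
  linarith

lemma achievable_of_wynerCommonInfo_lt {q : X × Y → ℝ} (hq : q ∈ stdSimplex ℝ (X × Y)) {R : ℝ}
    (h : wynerCommonInfo q < R) : Achievable q R 0 0 := by
  have hR : 0 ≤ R := (wynerCommonInfo_nonneg hq).trans h.le
  obtain ⟨t, ht, hI⟩ := mem_wynerValues_iff.1 (isLeast_wynerCommonInfo hq).1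
  obtain ⟨k, w, P, Q, hw, hP, hQ, hmix, rfl⟩ := exists_mixture_of_mem_convexHull ht
  rw [hI, div_lt_iff₀ (log_pos one_lt_two)] at h
  -- `L` lies strictly between I(X,Y;U) in nats and `R * log 2`: the first gap makes the Chernoff
  -- base `ρ` less than 1, the second makes e^{nL}/N vanish.
  obtain ⟨L, hL1, hL2⟩ := exists_between h
  obtain ⟨s, hs, hlt⟩ := exists_pos_sum_rpow_lt_one hw hP hQ hmix hL1
  set ρ := ∑ z : X × Y, ∑ u, w u * (P u z.1 * Q u z.2) *
      (P u z.1 * Q u z.2 / (exp L * q z)) ^ s with hρ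
  have hρ0 : 0 ≤ ρ := Finset.sum_nonneg fun z _ => Finset.sum_nonneg fun u _ =>
    mul_nonneg (mul_nonneg (hw.1 u) (mul_nonneg ((hP u).1 _) ((hQ u).1 _)))
      (rpow_nonneg (div_nonneg (mul_nonneg ((hP u).1 z.1) ((hQ u).1 z.2))
        (mul_nonneg (exp_pos L).le (hq.1 z))) _)
  choose c hc using fun n => exists_codebook_of_mixture hw hP hQ hmix L hs n
    (one_le_numIdx n hR)
  choose C hC using fun n => exists_simCode_of_codebook hR hP hQ (c n)
  refine ⟨hR, le_rfl, le_rfl, C, ?_⟩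
  have hbound : ∀ n, tvDist (C n).induced (iidPMF q n) ≤
      1 / 2 * (√(2 * (exp L / exp (R * log 2)) ^ n) + 2 * ρ ^ n) := by
    intro n
    rw [tvDist, ← Finset.mul_sum]
    simp only [hC]
    refine mul_le_mul_of_nonneg_left ((hc n).trans (add_le_add (sqrt_le_sqrt ?_) le_rfl))
      (by norm_num)
    rw [div_eq_mul_inv, div_pow, div_eq_mul_inv, mul_left_comm]
    exact mul_le_mul_of_nonneg_left (inv_numIdx_le n hR) (by positivity)
  refine squeeze_zero (fun n => Finset.sum_nonneg fun z _ => by positivity) hbound ?_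
  have h1 : Tendsto (fun n : ℕ => (exp L / exp (R * log 2)) ^ n) atTop (nhds 0) :=
    tendsto_pow_atTop_nhds_zero_of_lt_one (by positivity)
      ((div_lt_one (exp_pos _)).2 (exp_lt_exp.2 hL2))
  have h2 := tendsto_pow_atTop_nhds_zero_of_lt_one hρ0 hlt
  simpa using (((h1.const_mul 2).sqrt).add (h2.const_mul 2)).const_mul (1 / 2 : ℝ)

end Achievability

lemma isGLB_noSRRates {X Y : Type*} [Fintype X] [Fintype Y] {q : X × Y → ℝ}
    (hq : q ∈ stdSimplex ℝ (X × Y)) : IsGLB (noSRRates q) (wynerCommonInfo q) := by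
  refine ⟨fun R hR => ?_, fun b hb => le_of_forall_gt_imp_ge_of_dense fun R hR => ?_⟩
  · simpa using wynerCommonInfo_le_of_mem_rateRegion hq hR
  · exact hb (subset_closure (achievable_of_wynerCommonInfo_lt hq hR))

lemma noSRRates_nonempty {X Y : Type*} [Fintype X] [Fintype Y] {q : X × Y → ℝ}
    (hq : q ∈ stdSimplex ℝ (X × Y)) : (noSRRates q).Nonempty :=
  ⟨_, subset_closure (achievable_of_wynerCommonInfo_lt hq (lt_add_one _))⟩

end CoordSim

/-- The optimal transmission rate under no shared randomness equals Wyner's common information.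
The first two clauses say that the minimum and the infimum in the definitions of the two sides
are a genuine minimum and a genuine infimum. -/
theorem theorem3 {X Y : Type*} [Fintype X] [Fintype Y] (q : X × Y → ℝ)
    (hq : q ∈ stdSimplex ℝ (X × Y)) :
    IsLeast (CoordSim.wynerValues q) (CoordSim.wynerCommonInfo q) ∧
      IsGLB (CoordSim.noSRRates q) (CoordSim.optRateNoSR q) ∧
      CoordSim.optRateNoSR q = CoordSim.wynerCommonInfo q := by
  have hglb := CoordSim.isGLB_noSRRates hq
  have heq : CoordSim.optRateNoSR q = CoordSim.wynerCommonInfo q :=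
    hglb.csInf_eq (CoordSim.noSRRates_nonempty hq)
  exact ⟨CoordSim.isLeast_wynerCommonInfo hq, heq ▸ hglb, heq⟩
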